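/- Let $n\ge 0$ and write $\sigma(z)=z-z^{-1}$. Consider the $n\times n$ square grid whose vertices $(i,j)$ (row $i$ from the top, column $j$ from the left, $1\le i,j\le n$) all have degree four, the $4n$ boundary edges being included. A state of square ice with domain wall boundary is an orientation of all edges such that exactly two edges enter (and two leave) every vertex $(i,j)$, all left and right boundary edges point into the grid, and all top and bottom boundary edges point out of it. Given $a\in\mathbb C\setminus\{0\}$ and $\boldsymbol x=(x_1,\dots,x_n)$, $\boldsymbol y=(y_1,\dots,y_n)$ in $(\mathbb C\setminus\{0\})^n$, the vertex $(i,j)$ of a state has, with $z=x_i/y_j$, the weight $\sigma(a^2)$ if its two horizontal edges have opposite directions (both enter or both leave the vertex); the weight $\sigma(az)$ if its horizontal edges both point right and its vertical edges both point up, or its horizontal edges both point left and its vertical edges both point down; and the weight $\sigma(az^{-1})$ if its horizontal edges both point right and its vertical edges both point down, or its horizontal edges both point left and its vertical edges both point up. The weight of a state is the product of the weights of its $n^2$ vertices, and the partition function $Z(n;\boldsymbol x,\boldsymbol y)$ is the sum of the weights of all states. Then, for $a=e^{\mathrm i\pi/3}$, the function $Z(n;\boldsymbol x,\boldsymbol y)$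 is symmetric in the union of the coordinates of $\boldsymbol x$ and $\boldsymbol y$: if $(x_1',\dots,x_n',y_1',\dots,y_n')$ is any permutation of $(x_1,\dots,x_n,y_1,\dots,y_n)$, then $Z(n;\boldsymbol x',\boldsymbol y')=Z(n;\boldsymbol x,\boldsymbol y)$. -/

import Mathlib

namespace SquareIce

/-- The abbreviation `σ(x) = x - x⁻¹`. -/
noncomputable def sigma (x : ℂ) : ℂ := x - x⁻¹

/-- An orientation of all edges of the `n × n` square grid together with its `4n` boundary edges.
Rows are numbered from top to bottom and columns from left to right, starting at `0`.

The first component orients the horizontal edges: in row `i`, edge `j` (with `0 ≤ j ≤ n`) joins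
column `j - 1` to column `j` (so `0` is the left and `n` the right boundary edge), and `true` means
that it points to the right.

The second component orients the vertical edges: in column `j`, edge `i` (with `0 ≤ i ≤ n`) joins
row `i - 1` to row `i` (so `0` is the top and `n` the bottom boundary edge), and `true` means that
it points up. -/
abbrev Orientation (n : ℕ) : Type :=
  (Fin n → Fin (n + 1) → Bool) × (Fin (n + 1) → Fin n → Bool)

namespace Orientation

variable {n : ℕ}

/-- Does the edge to the left of the vertex in row `i` and column `j` point to the right? -/
def left (s : Orientation n) (i j : Fin n) : Bool := s.1 i j.castSucc

/-- Does the edge to the right of the vertex in row `i` and column `j` point to the right? -/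
def right (s : Orientation n) (i j : Fin n) : Bool := s.1 i j.succ

/-- Does the edge above the vertex in row `i` and column `j` point up? -/
def above (s : Orientation n) (i j : Fin n) : Bool := s.2 i.castSucc j

/-- Does the edge below the vertex in row `i` and column `j` point up? -/
def below (s : Orientation n) (i j : Fin n) : Bool := s.2 i.succ j

/-- The number of edges that enter the tetravalent vertex in row `i` and column `j`. -/
def inDegree (s : Orientation n) (i j : Fin n) : ℕ :=
  (if s.left i j = true then 1 else 0) + (if s.right i j = false then 1 else 0) +
    (if s.above i j = false then 1 else 0) + (if s.below i j = true then 1 else 0)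

/-- The ice rule (at each tetravalent vertex two edges enter, hence two leave) and the domain wall
boundary condition (horizontal boundary edges point into the grid, vertical ones out of it). -/
def IsState (s : Orientation n) : Prop :=
  (∀ i j, s.inDegree i j = 2) ∧
    (∀ i, s.1 i 0 = true ∧ s.1 i (Fin.last n) = false) ∧
    (∀ j, s.2 0 j = true ∧ s.2 (Fin.last n) j = false)

instance : DecidablePred (IsState (n := n)) := fun s => by
  unfold IsState
  infer_instance

/-- The weight, at spectral parameter `z`, of the vertex in row `i` and column `j` of a state.
By the ice rule there are six kinds of vertices. If the two horizontal edges point against each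
other (then so do the two vertical ones) the weight is `σ(a²)`. Otherwise both lines go straight
through the vertex: the weight is `σ(a z)` for the directions right/up and left/down and `σ(a z⁻¹)`
for the directions right/down and left/up. -/
noncomputable def vertexWeight (a : ℂ) (s : Orientation n) (i j : Fin n) (z : ℂ) : ℂ :=
  if s.left i j ≠ s.right i j then sigma (a ^ 2)
  else if s.left i j = s.above i j then sigma (a * z)
  else sigma (a * z⁻¹)

/-- The weight of a state; the row `i` carries `x i`, the column `j` carries `y j`, and the vertex
at their intersection has the spectral parameter `x i / y j`. -/
noncomputable def weight (a : ℂ) (x y : Fin n → ℂ) (s : Orientation n) : ℂ :=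
  ∏ i, ∏ j, s.vertexWeight a i j (x i / y j)

end Orientation

/-- The partition function `Z(n; x, y)` of the square ice model with domain wall boundary. -/
noncomputable def partitionFunction (a : ℂ) (n : ℕ) (x y : Fin n → ℂ) : ℂ :=
  ∑ s : Orientation n with s.IsState, s.weight a x y

end SquareIce

open scoped Kronecker

namespace SquareIce

/-! The proof is the Izergin–Korepin method combined with a feature of `a ^ 3 = -1`. By the
Yang–Baxter equation the transfer matrices of the rows commute, so Z is symmetric in x
(`partitionFunction_comp_perm_left`); reflecting the grid gives the symmetry in y and the invariance
under inverting all parameters.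

It remains to exchange one row parameter with one column parameter (`exchangeInvariant`), by
induction on the size. If σ(a x₀/y₀) = 0, the corner vertex forces the rest of the first row and
column, and Z factors into a product times the smaller partition function
(`partitionFunction_succ_of_sigma_eq_zero`). For `a ^ 3 = -1` the row factors and the column factors
are, up to sign, values of one and the same function (`exists_sigma_eq_mul_of_cube`), so the product
is symmetric in the remaining x and y jointly, and induction applies.

For size m, Z times x₀ ^ (m - 1) is a polynomial in x₀ of degree at most 2(m - 1). The
factorization, its inverse version and the column symmetry give the exchange identity at 3(m - 1)
values of x₀, which suffices if these are distinct (`exchange_of_norm_injective`); a perturbation of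
y and continuity cover the general case. The exchange together with the permutations of x and of y
generates all permutations. -/

/-! ### Ordered products of matrices. -/

theorem prod_ofFn_apply_eq_sum_paths {ι R : Type*} [Fintype ι] [DecidableEq ι] [CommSemiring R]
    (m : ℕ) (M : Fin m → Matrix ι ι R) (p q : ι) :
    (List.ofFn M).prod p q = ∑ v : Fin (m + 1) → ι,
      if v 0 = p ∧ v (Fin.last m) = q then ∏ i, M i (v i.castSucc) (v i.succ) else 0 := by
  induction m generalizing p with
  | zero =>
    rw [← (Equiv.funUnique (Fin 1) ι).symm.sum_comp]
    simp only [List.ofFn_zero, List.prod_nil, Matrix.one_apply]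
    by_cases h : p = q
    · subst h
      simp
    · rw [if_neg h, Finset.sum_eq_zero]
      intro c _
      rw [if_neg]
      rintro ⟨rfl, rfl⟩
      exact h rfl
  | succ m ih =>
    rw [← (Fin.consEquiv (fun _ : Fin (m + 2) => ι)).sum_comp, Fintype.sum_prod_type,
      List.ofFn_succ, List.prod_cons, Matrix.mul_apply]
    simp only [ih, Finset.mul_sum]
    rw [Finset.sum_comm, Finset.sum_comm (s := (Finset.univ : Finset ι))]
    refine Finset.sum_congr rfl fun v _ => ?_
    rw [Finset.sum_eq_single (v 0), Finset.sum_eq_single p]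
    · by_cases h : v (Fin.last m) = q
      · simp [Fin.consEquiv, Fin.prod_univ_succ, ← Fin.succ_last, h]
      · simp [Fin.consEquiv, ← Fin.succ_last, h]
    · intro c _ hc
      simp [Fin.consEquiv, hc]
    · simp
    · intro c _ hc
      rw [if_neg (fun h => hc h.1.symm), mul_zero]
    · simp

theorem sum_prod_ofFn {κ R : Type*} [Fintype κ] [Semiring R] (n : ℕ) (A : Fin n → κ → R) :
    ∑ γ : Fin n → κ, (List.ofFn fun j => A j (γ j)).prod =
      (List.ofFn fun j => ∑ c, A j c).prod := by
  induction n with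
  | zero => simp
  | succ n ih =>
    rw [← (Fin.consEquiv (fun _ : Fin (n + 1) => κ)).sum_comp, Fintype.sum_prod_type]
    simp only [List.ofFn_succ, List.prod_cons, Fin.consEquiv, Equiv.coe_fn_mk, Fin.cons_zero,
      Fin.cons_succ]
    rw [← ih, Finset.sum_mul_sum]

theorem prod_ofFn_kronecker {ι κ R : Type*} [Fintype ι] [DecidableEq ι] [Fintype κ]
    [DecidableEq κ] [CommSemiring R] (n : ℕ) (A : Fin n → Matrix ι ι R) (B : Fin n → Matrix κ κ R) :
    (List.ofFn fun j => A j ⊗ₖ B j).prod = (List.ofFn A).prod ⊗ₖ (List.ofFn B).prod := by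
  induction n with
  | zero => simp
  | succ n ih => simp [List.ofFn_succ, ih, Matrix.mul_kronecker_mul]

theorem semiconjBy_prod_ofFn {M : Type*} [Monoid M] (n : ℕ) (r : M) (A B : Fin n → M)
    (h : ∀ j, SemiconjBy r (A j) (B j)) :
    SemiconjBy r (List.ofFn A).prod (List.ofFn B).prod := by
  induction n with
  | zero => simp
  | succ n ih =>
    simp only [List.ofFn_succ, List.prod_cons]
    exact (h 0).mul_right (ih _ _ fun j => h j.succ)

/-! ### Yang–Baxter equation and commuting transfer matrices. -/

/-- The weight of a vertex with left, right, upper and lower edge `l`, `r`, `u`, `d`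
(`0` unless the ice rule holds). -/
noncomputable def localWeight (a z : ℂ) (u d l r : Bool) : ℂ :=
  if (if l = true then 1 else 0) + (if r = false then 1 else 0) +
    (if u = false then 1 else 0) + (if d = true then 1 else 0) = 2 then
    if l ≠ r then sigma (a ^ 2) else if l = u then sigma (a * z) else sigma (a * z⁻¹)
  else 0

/-- The matrix of local weights with fixed vertical edges. -/
noncomputable def lMatrix (a z : ℂ) (u d : Bool) : Matrix Bool Bool ℂ :=
  Matrix.of (localWeight a z u d)

/-- The transfer matrix of a row with spectral parameter `t`. -/
noncomputable def transfer (a : ℂ) {n : ℕ} (y : Fin n → ℂ) (t : ℂ) :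
    Matrix (Fin n → Bool) (Fin n → Bool) ℂ :=
  Matrix.of fun α β => (List.ofFn fun j => lMatrix a (t / y j) (α j) (β j)).prod true false

/-- The matrix of local weights of two vertices on top of each other. -/
noncomputable def doubleMatrix (a z w : ℂ) (u d : Bool) :
    Matrix (Bool × Bool) (Bool × Bool) ℂ :=
  ∑ c, lMatrix a z u c ⊗ₖ lMatrix a w c d

/-- The matrix that intertwines two rows. -/
noncomputable def rMatrix (a z w : ℂ) : Matrix (Bool × Bool) (Bool × Bool) ℂ :=
  Matrix.of fun p q =>
    if p = q then if p.1 = p.2 then sigma (a ^ 2 * (w / z)) else sigma (a ^ 2)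
    else if p = q.swap then sigma (z / w) else 0

/-- A finite check: each of the 64 choices of outer edges leaves a rational identity in `a`, `z`,
`w`. -/
theorem yang_baxter (a z w : ℂ) (ha : a ≠ 0) (hz : z ≠ 0) (hw : w ≠ 0) (u d : Bool) :
    SemiconjBy (rMatrix a z w) (doubleMatrix a z w u d) (doubleMatrix a w z u d) := by
  unfold SemiconjBy
  ext ⟨p₁, p₂⟩ ⟨q₁, q₂⟩
  simp only [doubleMatrix, rMatrix, lMatrix, Matrix.mul_apply, Fintype.sum_prod_type,
    Fintype.sum_bool, Matrix.add_apply, Matrix.kroneckerMap_apply, Matrix.of_apply]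
  cases u <;> cases d <;> cases p₁ <;> cases p₂ <;> cases q₁ <;> cases q₂ <;>
    simp [localWeight] <;> simp only [sigma] <;> field_simp <;> ring

theorem transfer_mul_transfer_apply (a : ℂ) {n : ℕ} (y : Fin n → ℂ) (t s : ℂ)
    (α β : Fin n → Bool) :
    (transfer a y t * transfer a y s) α β =
      (List.ofFn fun j => doubleMatrix a (t / y j) (s / y j) (α j) (β j)).prod
        (true, true) (false, false) := by
  have := sum_prod_ofFn n fun j c =>
    lMatrix a (t / y j) (α j) c ⊗ₖ lMatrix a (s / y j) c (β j)
  rw [show (fun j => doubleMatrix a (t / y j) (s / y j) (α j) (β j)) = fun j => ∑ c,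
    lMatrix a (t / y j) (α j) c ⊗ₖ lMatrix a (s / y j) c (β j) from rfl, ← this,
    Matrix.sum_apply, Matrix.mul_apply]
  refine Finset.sum_congr rfl fun γ _ => ?_
  rw [prod_ofFn_kronecker]
  rfl

/-- `rMatrix` is pulled through all columns. At the boundary indices (true, true) and (false, false)
only its diagonal entry is nonzero, and it is the same on both sides, so it cancels. -/
theorem transfer_mul_comm_of_ne (a : ℂ) {n : ℕ} (y : Fin n → ℂ) (t s : ℂ) (ha : a ≠ 0)
    (hy : ∀ j, y j ≠ 0) (ht : t ≠ 0) (hs : s ≠ 0) (h : sigma (a ^ 2 * (s / t)) ≠ 0) :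
    transfer a y t * transfer a y s = transfer a y s * transfer a y t := by
  ext α β
  rw [transfer_mul_transfer_apply, transfer_mul_transfer_apply]
  have key : SemiconjBy (rMatrix a t s)
      (List.ofFn fun j => doubleMatrix a (t / y j) (s / y j) (α j) (β j)).prod
      (List.ofFn fun j => doubleMatrix a (s / y j) (t / y j) (α j) (β j)).prod := by
    refine semiconjBy_prod_ofFn n _ _ _ fun j => ?_
    have := yang_baxter a (t / y j) (s / y j) ha (div_ne_zero ht (hy j)) (div_ne_zero hs (hy j))
      (α j) (β j)
    -- The intertwiner depends only on the ratio of its parameters, so one matrix serves every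
    -- column.
    rwa [show rMatrix a (t / y j) (s / y j) = rMatrix a t s by
      simp only [rMatrix, div_div_div_cancel_right₀ (hy j)]] at this
  have h2 := congrFun (congrFun key.eq (true, true)) (false, false)
  simp only [Matrix.mul_apply, Fintype.sum_prod_type, Fintype.sum_bool] at h2
  simp [rMatrix] at h2
  rw [mul_comm] at h2
  simpa [h] using h2

theorem commute_transfer (a : ℂ) {n : ℕ} (y : Fin n → ℂ) (t s : ℂ) (ha : a ≠ 0)
    (ha8 : a ^ 8 ≠ 1) (hy : ∀ j, y j ≠ 0) (ht : t ≠ 0) (hs : s ≠ 0) :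
    Commute (transfer a y t) (transfer a y s) := by
  by_cases h : sigma (a ^ 2 * (s / t)) = 0
  -- If the factor to cancel vanishes, the roles of `t` and `s` are exchanged; both factors vanish
  -- only if `a ^ 8 = 1`.
  · refine (transfer_mul_comm_of_ne a y s t ha hy hs ht fun h' => ha8 ?_).symm
    simp only [sigma] at h h'
    field_simp at h h'
    have h1 : a ^ 4 * s ^ 2 = t ^ 2 := by linear_combination h
    have h2 : a ^ 4 * t ^ 2 = s ^ 2 := by linear_combination h'
    have : (a ^ 8 - 1) * s ^ 2 = 0 := by linear_combination a ^ 4 * h1 + h2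
    rcases mul_eq_zero.1 this with h3 | h3
    · linear_combination h3
    · exact absurd h3 (pow_ne_zero 2 hs)
  · exact transfer_mul_comm_of_ne a y t s ha hy ht hs h

/-! ### Transfer matrix form of the partition function and symmetry in the rows. -/

theorem partitionFunction_eq_sum_localWeight (a : ℂ) (n : ℕ) (x y : Fin n → ℂ) :
    partitionFunction a n x y = ∑ v : Fin (n + 1) → Fin n → Bool,
      if v 0 = (fun _ => true) ∧ v (Fin.last n) = (fun _ => false) then
        ∑ h : Fin n → Fin (n + 1) → Bool, ∏ i,
          if h i 0 = true ∧ h i (Fin.last n) = false then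
            ∏ j, localWeight a (x i / y j) (v i.castSucc j) (v i.succ j) (h i j.castSucc)
              (h i j.succ)
          else 0
      else 0 := by
  unfold partitionFunction
  rw [Finset.sum_filter, Fintype.sum_prod_type_right]
  refine Finset.sum_congr rfl fun v _ => ?_
  split_ifs with hv
  · refine Finset.sum_congr rfl fun h _ => ?_
    split_ifs with hs
    · refine Finset.prod_congr rfl fun i _ => ?_
      rw [if_pos (hs.2.1 i)]
      refine Finset.prod_congr rfl fun j _ => ?_
      exact (if_pos (hs.1 i j)).symm
    -- An orientation that is not a state contributes zero: either some local weight or some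
    -- boundary indicator vanishes.
    · by_cases hb : ∀ i, h i 0 = true ∧ h i (Fin.last n) = false
      · have : ∃ i j, Orientation.inDegree (h, v) i j ≠ 2 := by
          by_contra! hc
          exact hs ⟨hc, hb, fun j => ⟨congrFun hv.1 j, congrFun hv.2 j⟩⟩
        obtain ⟨i, j, hij⟩ := this
        refine (Finset.prod_eq_zero (Finset.mem_univ i) ?_).symm
        rw [if_pos (hb i)]
        exact Finset.prod_eq_zero (Finset.mem_univ j) (if_neg hij)
      · push Not at hb
        obtain ⟨i, hi⟩ := hb
        refine (Finset.prod_eq_zero (Finset.mem_univ i) ?_).symm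
        rw [if_neg]
        exact fun h' => hi h'.1 h'.2
  · refine Finset.sum_eq_zero fun h _ => if_neg fun hs => hv ⟨?_, ?_⟩
    · exact funext fun j => (hs.2.2 j).1
    · exact funext fun j => (hs.2.2 j).2

theorem partitionFunction_eq_prod_transfer (a : ℂ) (n : ℕ) (x y : Fin n → ℂ) :
    partitionFunction a n x y =
      (List.ofFn fun i => transfer a y (x i)).prod (fun _ => true) (fun _ => false) := by
  rw [partitionFunction_eq_sum_localWeight, prod_ofFn_apply_eq_sum_paths]
  refine Finset.sum_congr rfl fun v _ => ?_
  congr 1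
  simp only [transfer, Matrix.of_apply, prod_ofFn_apply_eq_sum_paths]
  rw [Finset.prod_univ_sum, Fintype.piFinset_univ]
  rfl

theorem partitionFunction_comp_perm_left (a : ℂ) (n : ℕ) (x y : Fin n → ℂ) (ha : a ≠ 0)
    (ha8 : a ^ 8 ≠ 1) (hx : ∀ i, x i ≠ 0) (hy : ∀ j, y j ≠ 0) (e : Equiv.Perm (Fin n)) :
    partitionFunction a n (fun i => x (e i)) y = partitionFunction a n x y := by
  rw [partitionFunction_eq_prod_transfer, partitionFunction_eq_prod_transfer]
  have hp : (List.ofFn fun i => transfer a y (x (e i))).Perm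
      (List.ofFn fun i => transfer a y (x i)) :=
    Equiv.Perm.ofFn_comp_perm e fun i => transfer a y (x i)
  rw [hp.prod_eq' ?_]
  refine List.pairwise_iff_forall_sublist.2 fun {p q} hpq => ?_
  have hp := hpq.subset (List.mem_cons_self)
  have hq := hpq.subset (List.mem_cons_of_mem _ List.mem_cons_self)
  simp only [List.mem_ofFn] at hp hq
  obtain ⟨i, rfl⟩ := hp
  obtain ⟨j, rfl⟩ := hq
  exact commute_transfer a y _ _ ha ha8 hy (hx _) (hx _)

/-! ### Reflections of the grid. -/

theorem partitionFunction_eq_of_equiv (a : ℂ) (n : ℕ) (x y x' y' : Fin n → ℂ)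
    (e : Orientation n ≃ Orientation n) (he : ∀ s, (e s).IsState ↔ s.IsState)
    (hw : ∀ s : Orientation n, s.IsState → (e s).weight a x' y' = s.weight a x y) :
    partitionFunction a n x' y' = partitionFunction a n x y := by
  unfold partitionFunction
  symm
  refine Finset.sum_equiv e (fun s => by simp [he]) fun s hs => (hw s ?_).symm
  simpa using hs

/-- The reflection of an orientation at the main diagonal, with all edges reversed. -/
def transposeEquiv (n : ℕ) : Orientation n ≃ Orientation n where
  toFun s := (fun i j => s.2 j i, fun i j => s.1 j i)
  invFun s := (fun i j => s.2 j i, fun i j => s.1 j i)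
  left_inv _ := rfl
  right_inv _ := rfl

/-- The reflection of an orientation at the vertical axis. -/
def reflectEquiv (n : ℕ) : Orientation n ≃ Orientation n where
  toFun s := (fun i j => !s.1 i j.rev, fun i j => s.2 i j.rev)
  invFun s := (fun i j => !s.1 i j.rev, fun i j => s.2 i j.rev)
  left_inv s := by simp
  right_inv s := by simp

theorem inDegree_transposeEquiv {n : ℕ} (s : Orientation n) (i j : Fin n) :
    (transposeEquiv n s).inDegree i j = 2 ↔ s.inDegree j i = 2 := by
  simp only [Orientation.inDegree, Orientation.left, Orientation.right, Orientation.above,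
    Orientation.below, transposeEquiv, Equiv.coe_fn_mk]
  rcases (s.1 j i.castSucc).eq_false_or_eq_true with h₁ | h₁ <;>
    rcases (s.1 j i.succ).eq_false_or_eq_true with h₂ | h₂ <;>
    rcases (s.2 j.castSucc i).eq_false_or_eq_true with h₃ | h₃ <;>
    rcases (s.2 j.succ i).eq_false_or_eq_true with h₄ | h₄ <;> simp [h₁, h₂, h₃, h₄]

theorem inDegree_reflectEquiv {n : ℕ} (s : Orientation n) (i j : Fin n) :
    (reflectEquiv n s).inDegree i j = 2 ↔ s.inDegree i j.rev = 2 := by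
  simp only [Orientation.inDegree, Orientation.left, Orientation.right, Orientation.above,
    Orientation.below, reflectEquiv, Equiv.coe_fn_mk, Fin.rev_castSucc, Fin.rev_succ]
  rcases (s.1 i j.rev.castSucc).eq_false_or_eq_true with h₁ | h₁ <;>
    rcases (s.1 i j.rev.succ).eq_false_or_eq_true with h₂ | h₂ <;>
    rcases (s.2 i.castSucc j.rev).eq_false_or_eq_true with h₃ | h₃ <;>
      rcases (s.2 i.succ j.rev).eq_false_or_eq_true with h₄ | h₄ <;>
      simp [h₁, h₂, h₃, h₄]

/-- Inverting the parameters keeps the ratio at each vertex when rows and columns trade places. This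
transports the row symmetry to the columns. -/
theorem partitionFunction_transpose (a : ℂ) (n : ℕ) (x y : Fin n → ℂ) :
    partitionFunction a n (fun i => (y i)⁻¹) (fun j => (x j)⁻¹) = partitionFunction a n x y := by
  refine partitionFunction_eq_of_equiv a n x y _ _ (transposeEquiv n) (fun s => ?_) fun s hs => ?_
  · unfold Orientation.IsState
    simp only [inDegree_transposeEquiv]
    rw [forall_comm]
    exact and_congr_right fun _ => and_comm
  · unfold Orientation.weight
    rw [Finset.prod_comm]
    refine Finset.prod_congr rfl fun j _ => Finset.prod_congr rfl fun i _ => ?_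
    have := hs.1 j i
    simp only [Orientation.inDegree, Orientation.left, Orientation.right, Orientation.above,
      Orientation.below, transposeEquiv, Equiv.coe_fn_mk, Orientation.vertexWeight,
      inv_div_inv] at this ⊢
    rcases (s.1 j i.castSucc).eq_false_or_eq_true with h₁ | h₁ <;>
      rcases (s.1 j i.succ).eq_false_or_eq_true with h₂ | h₂ <;>
      rcases (s.2 j.castSucc i).eq_false_or_eq_true with h₃ | h₃ <;>
      rcases (s.2 j.succ i).eq_false_or_eq_true with h₄ | h₄ <;> simp_all

/-- The reflection interchanges the weights σ(az) and σ(a/z), which inverting the parameters undoes.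
-/
theorem partitionFunction_reflect (a : ℂ) (n : ℕ) (x y : Fin n → ℂ) :
    partitionFunction a n (fun i => (x i)⁻¹) (fun j => (y j.rev)⁻¹) =
      partitionFunction a n x y := by
  refine partitionFunction_eq_of_equiv a n x y _ _ (reflectEquiv n) (fun s => ?_) fun s _ => ?_
  · unfold Orientation.IsState
    simp only [inDegree_reflectEquiv]
    refine and_congr (forall_congr' fun i => ?_) (and_congr (forall_congr' fun i => ?_) ?_)
    · exact ⟨fun h j => by simpa using h j.rev, fun h j => h j.rev⟩
    · simp [reflectEquiv, and_comm]
    · simp only [reflectEquiv, Equiv.coe_fn_mk]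
      exact ⟨fun h j => by simpa using h j.rev, fun h j => h j.rev⟩
  · unfold Orientation.weight
    refine Finset.prod_congr rfl fun i _ => ?_
    rw [← Equiv.prod_comp Fin.revPerm]
    refine Finset.prod_congr rfl fun j _ => ?_
    simp only [Orientation.left, Orientation.right, Orientation.above,
      reflectEquiv, Equiv.coe_fn_mk, Orientation.vertexWeight, Fin.revPerm_apply, Fin.rev_rev,
      inv_div_inv, ← inv_div (x i), inv_inv, Fin.rev_castSucc, Fin.rev_succ]
    rcases (s.1 i j.castSucc).eq_false_or_eq_true with h₁ | h₁ <;>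
      rcases (s.1 i j.succ).eq_false_or_eq_true with h₂ | h₂ <;>
      rcases (s.2 i.castSucc j).eq_false_or_eq_true with h₃ | h₃ <;>
      simp [h₁, h₂, h₃]

theorem partitionFunction_comp_perm_right (a : ℂ) (n : ℕ) (x y : Fin n → ℂ) (ha : a ≠ 0)
    (ha8 : a ^ 8 ≠ 1) (hx : ∀ i, x i ≠ 0) (hy : ∀ j, y j ≠ 0) (e : Equiv.Perm (Fin n)) :
    partitionFunction a n x (fun j => y (e j)) = partitionFunction a n x y := by
  rw [← partitionFunction_transpose, ← partitionFunction_transpose a n x y]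
  exact partitionFunction_comp_perm_left a n (fun i => (y i)⁻¹) _ ha ha8
    (fun i => inv_ne_zero (hy i)) (fun j => inv_ne_zero (hx j)) e

theorem partitionFunction_inv (a : ℂ) (n : ℕ) (x y : Fin n → ℂ) (ha : a ≠ 0)
    (ha8 : a ^ 8 ≠ 1) (hx : ∀ i, x i ≠ 0) (hy : ∀ j, y j ≠ 0) :
    partitionFunction a n (fun i => (x i)⁻¹) (fun j => (y j)⁻¹) = partitionFunction a n x y := by
  rw [← partitionFunction_reflect a n x y]
  exact (partitionFunction_comp_perm_right a n _ (fun j => (y j)⁻¹) ha ha8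
    (fun i => inv_ne_zero (hx i)) (fun j => inv_ne_zero (hy j)) Fin.revPerm).symm

/-! ### Recursion at a zero of the corner weight. -/

namespace Orientation

variable {n : ℕ}

theorem right_below_of_left_false_above_true {s : Orientation n} {i j : Fin n}
    (h : s.inDegree i j = 2) (hl : s.left i j = false) (ha : s.above i j = true) :
    s.right i j = false ∧ s.below i j = true := by
  unfold inDegree at h
  rcases (s.right i j).eq_false_or_eq_true with hr | hr <;>
    rcases (s.below i j).eq_false_or_eq_true with hb | hb <;> simp_all

theorem right_below_of_left_true_above_false {s : Orientation n} {i j : Fin n}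
    (h : s.inDegree i j = 2) (hl : s.left i j = true) (ha : s.above i j = false) :
    s.right i j = true ∧ s.below i j = false := by
  unfold inDegree at h
  rcases (s.right i j).eq_false_or_eq_true with hr | hr <;>
    rcases (s.below i j).eq_false_or_eq_true with hb | hb <;> simp_all

theorem below_eq_right_of_left_true_above_true {s : Orientation n} {i j : Fin n}
    (h : s.inDegree i j = 2) (hl : s.left i j = true) (ha : s.above i j = true) :
    s.below i j = s.right i j := by
  unfold inDegree at h
  rcases (s.right i j).eq_false_or_eq_true with hr | hr <;>
    rcases (s.below i j).eq_false_or_eq_true with hb | hb <;> simp_all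

/-- The orientation of the `(n + 1) × (n + 1)` grid in which the vertex in the top left corner
has opposite horizontal edges, and the other vertices of the first row and column are frozen. -/
def extendCorner (s : Orientation n) : Orientation (n + 1) :=
  (Fin.cons (Fin.cons true fun _ => false) fun i => Fin.cons true (s.1 i),
    Fin.cons (fun _ => true) fun i => Fin.cons false (s.2 i))

theorem extendCorner_injective : Function.Injective (extendCorner (n := n)) := by
  intro s t h
  refine Prod.ext (funext fun i => funext fun j => ?_) (funext fun i => funext fun j => ?_)
  · simpa [extendCorner] using congrFun (congrFun (congrArg Prod.fst h) i.succ) j.succ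
  · simpa [extendCorner] using congrFun (congrFun (congrArg Prod.snd h) i.succ) j.succ

theorem inDegree_extendCorner_succ_succ (s : Orientation n) (i j : Fin n) :
    (extendCorner s).inDegree i.succ j.succ = s.inDegree i j := by
  simp only [inDegree, left, right, above, below, extendCorner, ← Fin.succ_castSucc, Fin.cons_succ]
  rfl

theorem isState_extendCorner {s : Orientation n} (hs : s.IsState) : s.extendCorner.IsState := by
  refine ⟨fun i j => ?_, fun i => ?_, fun j => ?_⟩
  · refine Fin.cases ?_ (fun i => ?_) i <;> refine Fin.cases ?_ (fun j => ?_) j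
    · simp [inDegree, left, right, above, below, extendCorner]
    · simp [inDegree, left, right, above, below, extendCorner, hs.2.2]
    · simp [inDegree, left, right, above, below, extendCorner, hs.2.1]
    · rw [inDegree_extendCorner_succ_succ, hs.1]
  · refine Fin.cases ?_ (fun i => ?_) i
    · simp [extendCorner, ← Fin.succ_last]
    · simp [extendCorner, ← Fin.succ_last, hs.2.1]
  · refine Fin.cases ?_ (fun j => ?_) j
    · simp [extendCorner, ← Fin.succ_last]
    · simp [extendCorner, ← Fin.succ_last, hs.2.2]

theorem weight_extendCorner (a : ℂ) (x y : Fin (n + 1) → ℂ) {s : Orientation n} (hs : s.IsState) :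
    s.extendCorner.weight a x y =
      sigma (a ^ 2) * (∏ j : Fin n, sigma (a * (x 0 / y j.succ)⁻¹)) *
        (∏ i : Fin n, sigma (a * (x i.succ / y 0)⁻¹)) *
        s.weight a (fun i => x i.succ) (fun j => y j.succ) := by
  have h00 (z : ℂ) : s.extendCorner.vertexWeight a 0 0 z = sigma (a ^ 2) := by
    simp [vertexWeight, left, right, extendCorner]
  have h0s (j : Fin n) (z : ℂ) :
      s.extendCorner.vertexWeight a 0 j.succ z = sigma (a * z⁻¹) := by
    simp [vertexWeight, left, right, above, extendCorner]
  have hs0 (i : Fin n) (z : ℂ) :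
      s.extendCorner.vertexWeight a i.succ 0 z = sigma (a * z⁻¹) := by
    simp [vertexWeight, left, right, above, extendCorner, hs.2.1]
  have hss (i j : Fin n) (z : ℂ) :
      s.extendCorner.vertexWeight a i.succ j.succ z = s.vertexWeight a i j z := by
    simp only [vertexWeight, left, right, above, extendCorner, ← Fin.succ_castSucc, Fin.cons_succ]
    rfl
  simp only [weight, Fin.prod_univ_succ (n := n), h00, h0s, hs0, hss, Finset.prod_mul_distrib]
  ring

/-- The ice rule spreads from the corner: the rest of the first row points left and the rest of the
first column points down, so the remaining grid again sees domain walls. -/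
theorem exists_eq_extendCorner {t : Orientation (n + 1)} (ht : t.IsState)
    (h : t.left 0 0 ≠ t.right 0 0) : ∃ s : Orientation n, s.IsState ∧ s.extendCorner = t := by
  have hl0 : t.left 0 0 = true := (ht.2.1 0).1
  have ha0 : t.above 0 0 = true := (ht.2.2 0).1
  have hr0 : t.right 0 0 = false := by
    rw [hl0] at h
    simpa using h.symm
  have hb0 : t.below 0 0 = false :=
    (below_eq_right_of_left_true_above_true (ht.1 0 0) hl0 ha0).trans hr0
  have row : ∀ j : Fin (n + 1), t.1 0 j.succ = false := by
    intro j
    induction j using Fin.induction with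
    | zero => exact hr0
    | succ j ih =>
      exact (right_below_of_left_false_above_true (ht.1 0 j.succ) ih (ht.2.2 j.succ).1).1
  have col : ∀ i : Fin (n + 1), t.2 i.succ 0 = false := by
    intro i
    induction i using Fin.induction with
    | zero => exact hb0
    | succ i ih =>
      exact (right_below_of_left_true_above_false (ht.1 i.succ 0) (ht.2.1 i.succ).1 ih).2
  have below_row : ∀ j : Fin n, t.2 1 j.succ = true := fun j =>
    (right_below_of_left_false_above_true (ht.1 0 j.succ) (row j.castSucc) (ht.2.2 j.succ).1).2
  have right_col : ∀ i : Fin n, t.1 i.succ 1 = true := fun i =>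
    (right_below_of_left_true_above_false (ht.1 i.succ 0) (ht.2.1 i.succ).1 (col i.castSucc)).1
  have he : extendCorner (n := n) (fun i j => t.1 i.succ j.succ, fun i j => t.2 i.succ j.succ) =
      t := by
    refine Prod.ext (funext fun i => funext fun j => ?_) (funext fun i => funext fun j => ?_)
    · refine Fin.cases ?_ (fun i => ?_) i <;> refine Fin.cases ?_ (fun j => ?_) j
      · exact hl0.symm
      · simpa [extendCorner] using (row j).symm
      · simpa [extendCorner] using (ht.2.1 i.succ).1.symm
      · simp [extendCorner]
    · refine Fin.cases ?_ (fun i => ?_) i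
      · simpa [extendCorner] using (ht.2.2 j).1.symm
      · refine Fin.cases ?_ (fun j => ?_) j
        · simpa [extendCorner] using (col i).symm
        · simp [extendCorner]
  refine ⟨_, ⟨fun i j => ?_, fun i => ⟨right_col i, ?_⟩, fun j => ⟨below_row j, ?_⟩⟩, he⟩
  · rw [← inDegree_extendCorner_succ_succ, he, ht.1]
  · exact (ht.2.1 i.succ).2
  · exact (ht.2.2 j.succ).2

end Orientation

/-- The boundary leaves the corner only the weights σ(a²) and σ(az); as the latter vanishes, only
the states from `extendCorner` survive. -/
theorem partitionFunction_succ_of_sigma_eq_zero (a : ℂ) (n : ℕ) (x y : Fin (n + 1) → ℂ)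
    (h : sigma (a * (x 0 / y 0)) = 0) :
    partitionFunction a (n + 1) x y =
      sigma (a ^ 2) * (∏ j : Fin n, sigma (a * (x 0 / y j.succ)⁻¹)) *
        (∏ i : Fin n, sigma (a * (x i.succ / y 0)⁻¹)) *
        partitionFunction a n (fun i => x i.succ) (fun j => y j.succ) := by
  unfold partitionFunction
  rw [Finset.mul_sum]
  symm
  refine Finset.sum_of_injOn Orientation.extendCorner
    Orientation.extendCorner_injective.injOn ?_ ?_ ?_
  · intro s hs
    simpa using Orientation.isState_extendCorner (by simpa using hs)
  · intro t ht hnot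
    have ht : t.IsState := by simpa using ht
    by_contra hw
    refine hnot ?_
    have h00 : t.left 0 0 ≠ t.right 0 0 := by
      intro heq
      refine hw (Finset.prod_eq_zero (Finset.mem_univ 0) (Finset.prod_eq_zero
        (Finset.mem_univ 0) ?_))
      rw [Orientation.vertexWeight, if_neg (not_not.2 heq), if_pos, h]
      exact (ht.2.1 0).1.trans (ht.2.2 0).1.symm
    obtain ⟨s, hs, rfl⟩ := Orientation.exists_eq_extendCorner ht h00
    exact ⟨s, by simpa using hs, rfl⟩
  · intro s hs
    exact (Orientation.weight_extendCorner a x y (by simpa using hs)).symm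

/-! ### Dependence on the parameters: polynomiality and continuity. -/

open Polynomial in
theorem exists_polynomial_vertexWeight (a : ℂ) (n : ℕ) (s : Orientation n) (i j : Fin n) (c : ℂ) :
    ∃ p : ℂ[X], p.natDegree ≤ 2 ∧
      ∀ t : ℂ, t ≠ 0 → t * s.vertexWeight a i j (t / c) = p.eval t := by
  unfold Orientation.vertexWeight
  split_ifs
  · exact ⟨C (sigma (a ^ 2)) * X, by compute_degree!, fun t _ => by
      rw [eval_mul, eval_C, eval_X, mul_comm]⟩
  · refine ⟨C (a / c) * X ^ 2 - C (a⁻¹ * c), by compute_degree!, fun t ht => ?_⟩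
    simp only [sigma, eval_sub, eval_mul, eval_C, eval_pow, eval_X, mul_inv, div_eq_mul_inv,
      inv_inv]
    field_simp
  · refine ⟨C (a * c) - C (a⁻¹ * c⁻¹) * X ^ 2, by compute_degree!, fun t ht => ?_⟩
    simp only [sigma, eval_sub, eval_mul, eval_C, eval_pow, eval_X, mul_inv, div_eq_mul_inv,
      inv_inv]
    field_simp

-- The horizontal edges of the first row turn around somewhere, so one of its n + 1 vertices has the
-- constant weight σ(a²). Only n vertices need a factor t, each giving degree at most 2.
open Polynomial in
theorem exists_polynomial_weight (a : ℂ) (n : ℕ) {s : Orientation (n + 1)} (hs : s.IsState)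
    (x : Fin n → ℂ) (y : Fin (n + 1) → ℂ) :
    ∃ p : ℂ[X], p.natDegree ≤ 2 * n ∧
      ∀ t : ℂ, t ≠ 0 → t ^ n * s.weight a (Fin.cons t x) y = p.eval t := by
  obtain ⟨k, hk⟩ : ∃ k, s.left 0 k ≠ s.right 0 k := by
    by_contra! hc
    have : ∀ j : Fin (n + 2), s.1 0 j = true := by
      intro j
      induction j using Fin.induction with
      | zero => exact (hs.2.1 0).1
      | succ j ih => exact (hc j).symm.trans ih
    simpa [this] using (hs.2.1 0).2
  choose p hp hpe using fun j => exists_polynomial_vertexWeight a (n + 1) s 0 j (y j)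
  refine ⟨C (sigma (a ^ 2) * ∏ i : Fin n, ∏ j, s.vertexWeight a i.succ j (x i / y j)) *
    ∏ j : Fin n, p (k.succAbove j), ?_, fun t ht => ?_⟩
  · refine (natDegree_C_mul_le _ _).trans ((natDegree_prod_le _ _).trans ?_)
    refine (Finset.sum_le_sum fun j _ => hp _).trans ?_
    simp [mul_comm]
  · have hk' : s.vertexWeight a 0 k (t / y k) = sigma (a ^ 2) := if_pos hk
    rw [eval_mul, eval_C, eval_prod, Orientation.weight, Fin.prod_univ_succ,
      Fin.prod_univ_succAbove _ k]
    simp only [Fin.cons_zero, Fin.cons_succ, hk', ← hpe _ t ht, Finset.prod_mul_distrib,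
      Finset.prod_const, Finset.card_univ, Fintype.card_fin]
    ring

open Polynomial in
theorem exists_polynomial_partitionFunction (a : ℂ) (n : ℕ) (x : Fin n → ℂ)
    (y : Fin (n + 1) → ℂ) :
    ∃ p : ℂ[X], p.natDegree ≤ 2 * n ∧
      ∀ t : ℂ, t ≠ 0 → t ^ n * partitionFunction a (n + 1) (Fin.cons t x) y = p.eval t := by
  have (s : Orientation (n + 1)) : ∃ p : ℂ[X], p.natDegree ≤ 2 * n ∧ (s.IsState →
      ∀ t : ℂ, t ≠ 0 → t ^ n * s.weight a (Fin.cons t x) y = p.eval t) := by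
    by_cases hs : s.IsState
    · obtain ⟨p, hp, hpe⟩ := exists_polynomial_weight a n hs x y
      exact ⟨p, hp, fun _ => hpe⟩
    · exact ⟨0, by simp, fun h => absurd h hs⟩
  choose p hp hpe using this
  refine ⟨∑ s : Orientation (n + 1) with s.IsState, p s,
    natDegree_sum_le_of_forall_le _ _ fun s _ => hp s, fun t ht => ?_⟩
  rw [partitionFunction, Finset.mul_sum, eval_finsetSum]
  exact Finset.sum_congr rfl fun s hs => hpe s (by simpa using hs) t ht

theorem continuous_partitionFunction {X : Type*} [TopologicalSpace X] (a : ℂ) (n : ℕ)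
    (ha : a ≠ 0) (x y : X → Fin n → ℂ) (hx : ∀ i, Continuous fun ε => x ε i)
    (hy : ∀ j, Continuous fun ε => y ε j) (hx0 : ∀ ε i, x ε i ≠ 0) (hy0 : ∀ ε j, y ε j ≠ 0) :
    Continuous fun ε => partitionFunction a n (x ε) (y ε) := by
  unfold partitionFunction Orientation.weight Orientation.vertexWeight
  refine continuous_finsetSum _ fun s _ => continuous_finsetProd _ fun i _ =>
    continuous_finsetProd _ fun j _ => ?_
  have hz : Continuous fun ε => x ε i / y ε j := (hx i).div (hy j) fun ε => hy0 ε j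
  have hz0 (ε) : x ε i / y ε j ≠ 0 := div_ne_zero (hx0 ε i) (hy0 ε j)
  unfold sigma
  split_ifs
  · exact continuous_const
  · have h := (continuous_const (y := a)).mul hz
    exact h.sub (h.inv₀ fun ε => mul_ne_zero ha (hz0 ε))
  · have h := (continuous_const (y := a)).mul (hz.inv₀ hz0)
    exact h.sub (h.inv₀ fun ε => mul_ne_zero ha (inv_ne_zero (hz0 ε)))

/-! ### Exchanging a row parameter with a column parameter. -/

/-- The tuple `x` with its last entry replaced by the last entry of `y`. -/
def exchangeLast {n : ℕ} (x y : Fin (n + 1) → ℂ) : Fin (n + 1) → ℂ :=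
  Function.update x (Fin.last n) (y (Fin.last n))

/-- Exchanging the last row parameter with the last column parameter does not change the
partition function of the grid of size `n + 1`. -/
def ExchangeInvariant (a : ℂ) (n : ℕ) : Prop :=
  ∀ x y : Fin (n + 1) → ℂ, (∀ i, x i ≠ 0) → (∀ j, y j ≠ 0) →
    partitionFunction a (n + 1) (exchangeLast x y) (exchangeLast y x) =
      partitionFunction a (n + 1) x y

theorem exchangeLast_ne_zero {n : ℕ} {x y : Fin (n + 1) → ℂ} (hx : ∀ i, x i ≠ 0)
    (hy : ∀ j, y j ≠ 0) (i : Fin (n + 1)) : exchangeLast x y i ≠ 0 := by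
  unfold exchangeLast
  by_cases h : i = Fin.last n
  · subst h
    simpa using hy _
  · simpa [h] using hx i

theorem exchangeLast_zero {n : ℕ} (x y : Fin (n + 2) → ℂ) : exchangeLast x y 0 = x 0 :=
  Function.update_of_ne (Fin.last_pos).ne _ _

theorem exchangeLast_succ {n : ℕ} (x y : Fin (n + 2) → ℂ) :
    (fun i : Fin (n + 1) => exchangeLast x y i.succ) =
      exchangeLast (fun i => x i.succ) (fun i => y i.succ) := by
  funext i
  by_cases h : i = Fin.last n
  · subst h
    simp [exchangeLast]
  · simp [exchangeLast, ← Fin.succ_last, h]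

theorem exchangeLast_comp {n : ℕ} (f : ℂ → ℂ) (x y : Fin (n + 1) → ℂ) (i : Fin (n + 1)) :
    exchangeLast (fun k => f (x k)) (fun k => f (y k)) i = f (exchangeLast x y i) := by
  by_cases h : i = Fin.last n
  · subst h
    simp [exchangeLast]
  · simp [exchangeLast, h]

theorem prod_exchangeLast {n : ℕ} (g : ℂ → ℂ) (x y : Fin (n + 1) → ℂ) :
    (∏ j, g (exchangeLast y x j)) * ∏ j, g (exchangeLast x y j) =
      (∏ j, g (y j)) * ∏ j, g (x j) := by
  rw [← Finset.prod_mul_distrib, ← Finset.prod_mul_distrib]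
  refine Finset.prod_congr rfl fun j _ => ?_
  by_cases h : j = Fin.last n
  · subst h
    simp [exchangeLast, mul_comm]
  · simp [exchangeLast, h]

theorem sigma_neg (z : ℂ) : sigma (-z) = -sigma z := by
  simp only [sigma, inv_neg]
  ring

theorem sigma_inv (z : ℂ) : sigma z⁻¹ = -sigma z := by
  simp only [sigma, inv_inv]
  ring

theorem sigma_eq_zero_iff {z : ℂ} (hz : z ≠ 0) : sigma z = 0 ↔ z = 1 ∨ z = -1 := by
  rw [← sq_eq_one_iff, sigma]
  field_simp
  rw [mul_zero, sub_eq_zero]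

/-- Here t = ±v/a, so az/t = ±a²z/v, and a² = -1/a turns this into ∓(av/z)⁻¹. Thus the frozen row
and the frozen column contribute the same function of their parameters, up to a sign `ε`. -/
theorem exists_sigma_eq_mul_of_cube {a t v : ℂ} (ha : a ^ 3 = -1) (ht : t ≠ 0) (hv : v ≠ 0)
    (h : sigma (a * (t / v)) = 0) :
    ∃ ε : ℂ, ∀ z ≠ 0, sigma (a * (t / z)⁻¹) = ε * sigma (a * (z / v)⁻¹) := by
  have ha0 : a ≠ 0 := by
    rintro rfl
    norm_num at ha
  have ainv : a⁻¹ = -a ^ 2 := by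
    field_simp
    linear_combination ha
  rcases (sigma_eq_zero_iff (mul_ne_zero ha0 (div_ne_zero ht hv))).1 h with h1 | h1
  · refine ⟨1, fun z hz => ?_⟩
    have ht' : t = a⁻¹ * v := by
      field_simp at h1 ⊢
      linear_combination h1
    have : a * (t / z)⁻¹ = -(a * (z / v)⁻¹)⁻¹ := by
      rw [ht']
      field_simp
      linear_combination ha
    rw [this, sigma_neg, sigma_inv]
    ring
  · refine ⟨-1, fun z hz => ?_⟩
    have ht' : t = -(a⁻¹ * v) := by
      field_simp at h1 ⊢
      linear_combination h1
    have : a * (t / z)⁻¹ = (a * (z / v)⁻¹)⁻¹ := by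
      rw [ht']
      field_simp
      linear_combination -ha
    rw [this, sigma_inv]
    ring

theorem exchange_of_sigma_zero_zero {a : ℂ} {n : ℕ} (ha : a ^ 3 = -1)
    (ih : ExchangeInvariant a n) {x y : Fin (n + 2) → ℂ} (hx : ∀ i, x i ≠ 0) (hy : ∀ j, y j ≠ 0)
    (h : sigma (a * (x 0 / y 0)) = 0) :
    partitionFunction a (n + 2) (exchangeLast x y) (exchangeLast y x) =
      partitionFunction a (n + 2) x y := by
  obtain ⟨ε, hε⟩ := exists_sigma_eq_mul_of_cube ha (hx 0) (hy 0) h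
  rw [partitionFunction_succ_of_sigma_eq_zero a (n + 1) x y h,
    partitionFunction_succ_of_sigma_eq_zero a (n + 1) (exchangeLast x y) (exchangeLast y x)
      (by rwa [exchangeLast_zero, exchangeLast_zero])]
  simp only [exchangeLast_zero, exchangeLast_succ, hε _ (hy _),
    hε _ (exchangeLast_ne_zero hy hx _), Finset.prod_mul_distrib]
  rw [ih _ _ (fun i => hx _) (fun j => hy _)]
  have := prod_exchangeLast (fun z => sigma (a * (z / y 0)⁻¹)) (fun i => x i.succ)
    (fun j => y j.succ)
  simp only [← exchangeLast_succ] at this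
  linear_combination (sigma (a ^ 2) * (∏ _j : Fin (n + 1), ε) *
    partitionFunction a (n + 1) (fun i => x i.succ) (fun j => y j.succ)) * this

theorem exchange_of_sigma_zero {a : ℂ} {n : ℕ} (ha : a ^ 3 = -1) (ha8 : a ^ 8 ≠ 1)
    (ih : ExchangeInvariant a n) {x y : Fin (n + 2) → ℂ} (hx : ∀ i, x i ≠ 0) (hy : ∀ j, y j ≠ 0)
    (j : Fin (n + 1)) (h : sigma (a * (x 0 / y j.castSucc)) = 0) :
    partitionFunction a (n + 2) (exchangeLast x y) (exchangeLast y x) =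
      partitionFunction a (n + 2) x y := by
  have ha0 : a ≠ 0 := by
    rintro rfl
    norm_num at ha
  -- Column `j.castSucc` is moved to the corner; it is never the last one, so the swap does not
  -- disturb the exchanged parameter.
  set e : Equiv.Perm (Fin (n + 2)) := Equiv.swap 0 j.castSucc with he
  have hlast : e (Fin.last (n + 1)) = Fin.last (n + 1) :=
    Equiv.swap_apply_of_ne_of_ne Fin.last_pos.ne' (Fin.castSucc_lt_last j).ne'
  have key := exchange_of_sigma_zero_zero ha ih hx (y := fun k => y (e k)) (fun k => hy _)
    (by simpa [he] using h)
  have h1 : exchangeLast x (fun k => y (e k)) = exchangeLast x y := by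
    simp only [exchangeLast, hlast]
  have h2 : exchangeLast (fun k => y (e k)) x = fun k => exchangeLast y x (e k) := by
    funext k
    by_cases hk : k = Fin.last (n + 1)
    · subst hk
      simp [exchangeLast, hlast]
    · have : e k ≠ Fin.last (n + 1) := fun h' => hk (e.injective (h'.trans hlast.symm))
      simp [exchangeLast, hk, this]
  rwa [h1, h2, partitionFunction_comp_perm_right a (n + 2) x y ha0 ha8 hx hy,
    partitionFunction_comp_perm_right a (n + 2) _ _ ha0 ha8 (exchangeLast_ne_zero hx hy)
      (exchangeLast_ne_zero hy hx)] at key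

theorem exchange_of_sigma_inv_zero {a : ℂ} {n : ℕ} (ha : a ^ 3 = -1) (ha8 : a ^ 8 ≠ 1)
    (ih : ExchangeInvariant a n) {x y : Fin (n + 2) → ℂ} (hx : ∀ i, x i ≠ 0) (hy : ∀ j, y j ≠ 0)
    (j : Fin (n + 1)) (h : sigma (a * (x 0 / y j.castSucc)⁻¹) = 0) :
    partitionFunction a (n + 2) (exchangeLast x y) (exchangeLast y x) =
      partitionFunction a (n + 2) x y := by
  have ha0 : a ≠ 0 := by
    rintro rfl
    norm_num at ha
  rw [← partitionFunction_inv a _ x y ha0 ha8 hx hy,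
    ← partitionFunction_inv a _ _ _ ha0 ha8 (exchangeLast_ne_zero hx hy)
      (exchangeLast_ne_zero hy hx)]
  have key := exchange_of_sigma_zero ha ha8 ih (x := fun i => (x i)⁻¹) (y := fun j => (y j)⁻¹)
    (fun i => inv_ne_zero (hx i)) (fun i => inv_ne_zero (hy i)) j
    (by rwa [inv_div_inv, ← inv_div])
  simpa only [funext (exchangeLast_comp (·⁻¹) x y), funext (exchangeLast_comp (·⁻¹) y x)]
    using key

theorem norm_eq_one_of_cube {a : ℂ} (ha : a ^ 3 = -1) : ‖a‖ = 1 := by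
  have h : ‖a‖ ^ 3 = 1 := by rw [← norm_pow, ha, norm_neg, norm_one]
  exact (pow_eq_one_iff_of_nonneg (norm_nonneg a) (by norm_num)).1 h

-- Both sides, as functions of the first row parameter, become polynomials of degree at most 2(n +
-- 1); they agree at 3(n + 1) points. Distinct moduli of the column parameters make these points
-- distinct.
open Polynomial in
theorem exchange_of_norm_injective {a : ℂ} {n : ℕ} (ha : a ^ 3 = -1) (ha2 : a ^ 2 ≠ 1)
    (ih : ExchangeInvariant a n) {x y : Fin (n + 2) → ℂ} (hx : ∀ i, x i ≠ 0) (hy : ∀ j, y j ≠ 0)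
    (hinj : Function.Injective fun j => ‖y j‖) :
    partitionFunction a (n + 2) (exchangeLast x y) (exchangeLast y x) =
      partitionFunction a (n + 2) x y := by
  have ha0 : a ≠ 0 := by
    rintro rfl
    norm_num at ha
  have ha8 : a ^ 8 ≠ 1 := by
    -- `a ^ 3 = -1` gives `a ^ 6 = 1`.
    rwa [show a ^ 8 = a ^ 2 by linear_combination (a ^ 5 - a ^ 2) * ha]
  have ha1 : ‖a‖ = 1 := norm_eq_one_of_cube ha
  set x' : Fin (n + 1) → ℂ := fun i => x i.succ with hx'
  set y' : Fin (n + 2) → ℂ := exchangeLast y x with hy'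
  set x'' : Fin (n + 1) → ℂ := fun i => exchangeLast x y i.succ with hx''
  obtain ⟨p, hp, hpe⟩ := exists_polynomial_partitionFunction a (n + 1) x' y
  obtain ⟨q, hq, hqe⟩ := exists_polynomial_partitionFunction a (n + 1) x'' y'
  have hcons (t : ℂ) : exchangeLast (Fin.cons t x' : Fin (n + 2) → ℂ) y = Fin.cons t x'' := by
    funext i
    refine Fin.cases ?_ (fun i => ?_) i
    · rw [exchangeLast_zero, Fin.cons_zero, Fin.cons_zero]
    · have := congrFun (exchangeLast_succ (Fin.cons t x' : Fin (n + 2) → ℂ) y) i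
      simp only [Fin.cons_succ] at this
      rw [this, Fin.cons_succ, hx'', exchangeLast_succ]
  have hcons' (t : ℂ) : exchangeLast y (Fin.cons t x' : Fin (n + 2) → ℂ) = y' := by
    simp only [hy', exchangeLast, ← Fin.succ_last, Fin.cons_succ, hx']
  have hcx (t : ℂ) (ht : t ≠ 0) (i : Fin (n + 2)) : (Fin.cons t x' : Fin (n + 2) → ℂ) i ≠ 0 := by
    refine Fin.cases ht (fun i => ?_) i
    exact hx i.succ
  -- σ(at/v) vanishes at t = ±v/a and σ(av/t) at t = ±av; three of these four zeros per column are
  -- enough.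
  let u : Fin 3 → ℂ := ![a⁻¹, -a⁻¹, a]
  have hu : Function.Injective u := by
    have h1 : a⁻¹ ≠ -a⁻¹ := fun h => inv_ne_zero ha0 (by linear_combination h / 2)
    have h2 : a⁻¹ ≠ a := fun h => ha2 (by rw [sq]; nth_rw 1 [← h]; exact inv_mul_cancel₀ ha0)
    have h3 : -a⁻¹ ≠ a := fun h => by
      have h4 : a ^ 2 = -1 := by
        rw [sq]; nth_rw 1 [← h]; rw [neg_mul, inv_mul_cancel₀ ha0]
      have h5 : a = 1 := by linear_combination a * h4 - ha
      exact ha2 (by rw [h5, one_pow])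
    intro i j hij
    fin_cases i <;> fin_cases j <;> simp [u] at hij ⊢ <;>
      first
        | exact h1 hij | exact h1 hij.symm | exact h2 hij | exact h2 hij.symm
        | exact h3 hij | exact h3 hij.symm
  have hu1 (k : Fin 3) : ‖u k‖ = 1 := by
    fin_cases k <;> simp [u, ha1]
  have hu0 (k : Fin 3) : u k ≠ 0 := by
    rw [← norm_ne_zero_iff, hu1]
    exact one_ne_zero
  let f : Fin 3 × Fin (n + 1) → ℂ := fun k => u k.1 * y k.2.castSucc
  have hf : Function.Injective f := by
    rintro ⟨k, i⟩ ⟨l, j⟩ h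
    -- All `u k` have modulus one, so the modulus of a point already determines its column.
    have h1 : i = j := by
      have := congrArg norm h
      simp only [f, norm_mul, hu1, one_mul] at this
      exact Fin.castSucc_injective _ (hinj this)
    subst h1
    exact Prod.ext (hu (mul_right_cancel₀ (hy _) h)) rfl
  have hzero : q - p = 0 := by
    refine eq_zero_of_natDegree_lt_card_of_eval_eq_zero _ hf ?_ ?_
    · rintro ⟨k, j⟩
      have hf0 : f (k, j) ≠ 0 := mul_ne_zero (hu0 k) (hy _)
      rw [eval_sub, ← hpe _ hf0, ← hqe _ hf0, ← mul_sub, ← hcons, ← hcons' (f (k, j)), sub_eq_zero.2,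
        mul_zero]
      have hyj := hy j.castSucc
      fin_cases k
      · refine exchange_of_sigma_zero ha ha8 ih (hcx _ hf0) hy j ?_
        simp [f, u, hyj, ha0, sigma]
      · refine exchange_of_sigma_zero ha ha8 ih (hcx _ hf0) hy j ?_
        simp [f, u, hyj, ha0, sigma, neg_div]
      · refine exchange_of_sigma_inv_zero ha ha8 ih (hcx _ hf0) hy j ?_
        simp [f, u, hyj, ha0, sigma]
    · refine (natDegree_sub_le_of_le hq hp).trans_lt ?_
      simp only [max_self, Fintype.card_prod, Fintype.card_fin]
      omega
  have hx0 := hx 0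
  have h1 := hpe _ hx0
  have h2 := hqe _ hx0
  rw [sub_eq_zero.1 hzero, ← h1, ← hcons] at h2
  have h3 : (Fin.cons (x 0) x' : Fin (n + 2) → ℂ) = x := Fin.cons_self_tail x
  rw [h3] at h2
  exact mul_left_cancel₀ (pow_ne_zero _ hx0) h2

/-! ### Removing the genericity assumption. -/

/-- Equal entries are separated by their different exponents as soon as ε ≠ 0; different entries
stay different for small ε. -/
theorem eventually_injective_mul_exp {n : ℕ} (r : Fin n → ℝ) (hr : ∀ i, r i ≠ 0) :
    ∀ᶠ ε : ℝ in nhdsWithin 0 {0}ᶜ,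
      Function.Injective fun j => r j * Real.exp (ε * (j : ℕ)) := by
  have key : ∀ᶠ ε : ℝ in nhdsWithin 0 {0}ᶜ, ∀ i j : Fin n, i ≠ j →
      r i * Real.exp (ε * (i : ℕ)) ≠ r j * Real.exp (ε * (j : ℕ)) := by
    simp only [Filter.eventually_all]
    intro i j hij
    by_cases h : r i = r j
    · filter_upwards [self_mem_nhdsWithin] with ε hε heq
      rw [h] at heq
      have h1 := Real.exp_injective (mul_left_cancel₀ (hr j) heq)
      have h2 := mul_left_cancel₀ hε h1
      exact hij (Fin.ext (by exact_mod_cast h2))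
    · have hc : Continuous fun ε : ℝ =>
          r i * Real.exp (ε * (i : ℕ)) - r j * Real.exp (ε * (j : ℕ)) := by fun_prop
      have := (hc.continuousAt (x := 0)).eventually_ne (y := 0) (by simpa [sub_eq_zero] using h)
      filter_upwards [this.filter_mono nhdsWithin_le_nhds] with ε hε
      exact sub_ne_zero.1 hε
  filter_upwards [key] with ε hε i j hij
  by_contra h
  exact hε i j h hij

theorem exchangeInvariant_succ {a : ℂ} {n : ℕ} (ha : a ^ 3 = -1) (ha2 : a ^ 2 ≠ 1)
    (ih : ExchangeInvariant a n) : ExchangeInvariant a (n + 1) := by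
  intro x y hx hy
  have ha0 : a ≠ 0 := by
    rintro rfl
    norm_num at ha
  let y' : ℝ → Fin (n + 2) → ℂ := fun ε j => y j * Complex.exp (ε * (j : ℕ))
  have hy'0 (ε j) : y' ε j ≠ 0 := mul_ne_zero (hy j) (Complex.exp_ne_zero _)
  have hy'c (j) : Continuous fun ε => y' ε j := by fun_prop
  have hz : y' 0 = y := by
    funext j
    simp [y']
  have hex (j) : Continuous fun ε => exchangeLast x (y' ε) j := by
    by_cases hj : j = Fin.last (n + 1)
    · subst hj
      simpa [exchangeLast] using hy'c (Fin.last (n + 1))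
    · simpa [exchangeLast, hj] using continuous_const
  have hey (j) : Continuous fun ε => exchangeLast (y' ε) x j := by
    by_cases hj : j = Fin.last (n + 1)
    · subst hj
      simpa [exchangeLast] using continuous_const
    · simpa [exchangeLast, hj] using hy'c j
  have h1 := continuous_partitionFunction a (n + 2) ha0 (fun _ : ℝ => x) y'
    (fun _ => continuous_const) hy'c (fun _ => hx) hy'0
  have h2 := continuous_partitionFunction a (n + 2) ha0 (fun ε : ℝ => exchangeLast x (y' ε))
    (fun ε => exchangeLast (y' ε) x) hex hey (fun ε => exchangeLast_ne_zero hx (hy'0 ε))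
    (fun ε => exchangeLast_ne_zero (hy'0 ε) hx)
  have := tendsto_nhds_unique_of_eventuallyEq (l := nhdsWithin (0 : ℝ) {0}ᶜ)
    ((h2.tendsto 0).mono_left nhdsWithin_le_nhds) ((h1.tendsto 0).mono_left nhdsWithin_le_nhds) ?_
  · simpa only [hz] using this
  · filter_upwards [eventually_injective_mul_exp (fun j => ‖y j‖)
      fun j => norm_ne_zero_iff.2 (hy j)] with ε hε
    refine exchange_of_norm_injective ha ha2 ih hx (hy'0 ε) ?_
    convert hε using 3 with j
    simp [y', Complex.norm_exp]

/-- The single vertex has weight σ(a²), which does not involve the parameters. -/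
theorem exchangeInvariant_zero (a : ℂ) : ExchangeInvariant a 0 := by
  intro x y _ _
  unfold partitionFunction
  refine Finset.sum_congr rfl fun s hs => ?_
  have hs : s.IsState := by simpa using hs
  have h : s.left 0 0 ≠ s.right 0 0 := by
    have h1 : s.left 0 0 = true := (hs.2.1 0).1
    have h2 : s.right 0 0 = false := (hs.2.1 0).2
    simp [h1, h2]
  simp [Orientation.weight, Orientation.vertexWeight, h]

theorem exchangeInvariant {a : ℂ} (ha : a ^ 3 = -1) (ha2 : a ^ 2 ≠ 1) (n : ℕ) :
    ExchangeInvariant a n := by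
  induction n with
  | zero => exact exchangeInvariant_zero a
  | succ n ih => exact exchangeInvariant_succ ha ha2 ih

/-! ### Generating all permutations. -/

/-- The permutations of the row and column parameters that preserve the partition function. -/
def symmetrySubmonoid (a : ℂ) (n : ℕ) : Submonoid (Equiv.Perm (Fin n ⊕ Fin n)) where
  carrier := {e | ∀ f : Fin n ⊕ Fin n → ℂ, (∀ k, f k ≠ 0) →
    partitionFunction a n (fun i => f (e (Sum.inl i))) (fun j => f (e (Sum.inr j))) =
      partitionFunction a n (fun i => f (Sum.inl i)) (fun j => f (Sum.inr j))}
  one_mem' := fun _ _ => rfl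
  mul_mem' := fun {e _} he he' f hf =>
    (he' (fun k => f (e k)) fun _ => hf _).trans (he f hf)

theorem sumCongr_mem_symmetrySubmonoid {a : ℂ} (n : ℕ) (ha0 : a ≠ 0) (ha8 : a ^ 8 ≠ 1)
    (e e' : Equiv.Perm (Fin n)) : Equiv.Perm.sumCongr e e' ∈ symmetrySubmonoid a n := by
  intro f hf
  simp only [Equiv.Perm.sumCongr_apply, Sum.map_inl, Sum.map_inr]
  rw [partitionFunction_comp_perm_left a n (fun i => f (Sum.inl i)) _ ha0 ha8 (fun _ => hf _)
      (fun _ => hf _),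
    partitionFunction_comp_perm_right a n _ (fun j => f (Sum.inr j)) ha0 ha8 (fun _ => hf _)
      (fun _ => hf _)]

theorem swap_inl_inr_mem_symmetrySubmonoid {a : ℂ} (n : ℕ) (ha : a ^ 3 = -1) (ha2 : a ^ 2 ≠ 1)
    (ha0 : a ≠ 0) (ha8 : a ^ 8 ≠ 1) (i j : Fin n) :
    Equiv.swap (Sum.inl i) (Sum.inr j) ∈ symmetrySubmonoid a n := by
  obtain _ | n := n
  · exact i.elim0
  have hlast : Equiv.swap (Sum.inl (Fin.last n)) (Sum.inr (Fin.last n)) ∈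
      symmetrySubmonoid a (n + 1) := by
    intro f hf
    rw [← exchangeInvariant ha ha2 n _ _ (fun _ => hf _) fun _ => hf _]
    congr 1 <;> funext k <;> by_cases h : k = Fin.last n
    · simp [exchangeLast, h]
    · simp [exchangeLast, h, Equiv.swap_apply_of_ne_of_ne]
    · simp [exchangeLast, h]
    · simp [exchangeLast, h, Equiv.swap_apply_of_ne_of_ne]
  -- Conjugation by `g` carries the exchange of the last row and column parameters to that of row
  -- `i` and column `j`.
  set g := Equiv.Perm.sumCongr (Equiv.swap i (Fin.last n)) (Equiv.swap j (Fin.last n)) with hg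
  have hgm : g ∈ symmetrySubmonoid a (n + 1) := sumCongr_mem_symmetrySubmonoid _ ha0 ha8 _ _
  have hgm' : g⁻¹ ∈ symmetrySubmonoid a (n + 1) := by
    rw [hg, Equiv.Perm.sumCongr_inv]
    exact sumCongr_mem_symmetrySubmonoid _ ha0 ha8 _ _
  have h1 : g (Sum.inl (Fin.last n)) = Sum.inl i := by simp [hg]
  have h2 : g (Sum.inr (Fin.last n)) = Sum.inr j := by simp [hg]
  have := mul_mem (mul_mem hgm hlast) hgm'
  rwa [Equiv.mul_swap_eq_swap_mul, mul_inv_cancel_right, h1, h2] at this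

theorem mem_symmetrySubmonoid {a : ℂ} (n : ℕ) (ha : a ^ 3 = -1) (ha2 : a ^ 2 ≠ 1)
    (e : Equiv.Perm (Fin n ⊕ Fin n)) : e ∈ symmetrySubmonoid a n := by
  have ha0 : a ≠ 0 := by
    rintro rfl
    norm_num at ha
  have ha8 : a ^ 8 ≠ 1 := by
    rwa [show a ^ 8 = a ^ 2 by linear_combination (a ^ 5 - a ^ 2) * ha]
  induction e using Equiv.Perm.swap_induction_on with
  | one => exact one_mem _
  | swap_mul f k l _ ih =>
    refine mul_mem ?_ ih
    rcases k with i | i <;> rcases l with j | j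
    · rw [← Equiv.Perm.sumCongr_swap_refl]
      exact sumCongr_mem_symmetrySubmonoid n ha0 ha8 _ _
    · exact swap_inl_inr_mem_symmetrySubmonoid n ha ha2 ha0 ha8 i j
    · rw [Equiv.swap_comm]
      exact swap_inl_inr_mem_symmetrySubmonoid n ha ha2 ha0 ha8 j i
    · rw [← Equiv.Perm.sumCongr_refl_swap]
      exact sumCongr_mem_symmetrySubmonoid n ha0 ha8 _ _

end SquareIce

theorem mainTheorem8 (n : ℕ) (x y : Fin n → ℂ) (hx : ∀ i, x i ≠ 0) (hy : ∀ j, y j ≠ 0)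
    (π : Equiv.Perm (Fin n ⊕ Fin n)) :
    SquareIce.partitionFunction (Complex.exp (Complex.I * (Real.pi : ℂ) / 3)) n
        (fun i => Sum.elim x y (π (Sum.inl i))) (fun j => Sum.elim x y (π (Sum.inr j))) =
      SquareIce.partitionFunction (Complex.exp (Complex.I * (Real.pi : ℂ) / 3)) n x y := by
  refine SquareIce.mem_symmetrySubmonoid n ?_ ?_ π (Sum.elim x y) ?_
  · rw [← Complex.exp_nat_mul, ← Complex.exp_pi_mul_I]
    congr 1
    push_cast
    ring
  · rw [← Complex.exp_nat_mul, Ne, Complex.exp_eq_one_iff]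
    rintro ⟨k, hk⟩
    have hpi : (Real.pi : ℂ) ≠ 0 := by exact_mod_cast Real.pi_ne_zero
    -- `a ^ 2 = 1` would mean 2πi/3 = 2πik, which has no integer solution `k`.
    have h1 : (1 : ℂ) = 3 * k := by
      have : (Real.pi : ℂ) * Complex.I * 2 * (1 - 3 * k) = 0 := by
        push_cast at hk
        linear_combination 3 * hk
      simp [hpi, sub_eq_zero] at this
      exact this
    have h2 : (1 : ℤ) = 3 * k := by exact_mod_cast h1
    omega
  · rintro (i | j)
    exacts [hx i, hy j]
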